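/- Let $G$ be a finitely generated group. Let $G_1=G$, $G_{i+1}=[G,G_i]$ be its lower central series, and let $\overline G_i=\{c\in G : c^n\in G_i \text{ for some integer } n\ge 1\}$. These are normal subgroups, and the quotients $\overline G_i/\overline G_{i+1}$ are torsion-free abelian of finite rank; write $d_i$ for the rank of $\overline G_i/\overline G_{i+1}$ and $n_i=d_1+\cdots+d_i$ (with $n_0=0$). A (possibly finite) sequence $e_1,e_2,\ldots$ of elements of $G$ is a \emph{coordinate system} on $G$ if for every $i\ge1$ the elements $e_{n_{i-1}+1},\ldots,e_{n_i}$ lie in $\overline G_i$ and their images form a basis of $\overline G_i/\overline G_{i+1}$. The \emph{coordinates} of $x\in G$ are then the unique integers $x_1,x_2,\ldots$ with $$x\,\overline G_{k+1}=e_1^{x_1}\cdots e_{n_k}^{x_{n_k}}\,\overline G_{k+1}\qquad\text{for every } k .$$ Put $\sigma(i)=\sup\{k\in\mathbb N: e_i\in\overline G_k\}$. A \emph{coordinate monomial} is a function $q:G\to\mathbb C$ of the form $q(x)=\lambda x_1^{a_1}\cdots x_r^{a_r}$ with $\lambda\in\mathbb C$, $r\le n_k$ for some $k$, and integers $a_i\ge0$;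 its degree is $\sigma(1)a_1+\cdots+\sigma(r)a_r$. A function is a \emph{coordinate polynomial of degree at most $k$} if it is a finite (possibly empty) sum of coordinate monomials, each of degree at most $k$. For $f:G\to\mathbb C$ and $u\in G$ let $\partial_uf(x)=f(ux)-f(x)$. For an integer $k\ge0$ let $P^k(G)$ be the space of all $f:G\to\mathbb C$ with $\partial_{u_1}\cdots\partial_{u_{k+1}}f=0$ for all $u_1,\ldots,u_{k+1}\in G$, and let $P^k(G)=\{0\}$ for $k<0$. Let $e_1,e_2,\ldots$ be a coordinate system on $G$, let $f:G\to\mathbb C$ and let $k\in\mathbb Z$. Then $f\in P^k(G)$ if and only if $f$ is a coordinate polynomial of degree at most $k$ with respect to $e_1,e_2,\ldots$. -/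

import Mathlib

open scoped commutatorElement

namespace GroupPoly

universe u

theorem commutator_normalClosure_le {G : Type u} [Group G] (a : G) :
    ⁅Subgroup.normalClosure ({a} : Set G), Subgroup.normalClosure ({a} : Set G)⁆ ≤
      (⊤ : Subgroup G).lowerCentralSeries 2 := by
  set K := (⊤ : Subgroup G).lowerCentralSeries 2 with hK
  have key : ∀ x : G, x ∈ ⁅(⊤ : Subgroup G), (⊤ : Subgroup G)⁆ → ∀ y : G, Commute (x : G ⧸ K) (y : G ⧸ K) := by
    intro x hx y
    rw [← commutatorElement_eq_one_iff_commute]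
    change ((⁅x, y⁆ : G) : G ⧸ K) = 1
    rw [QuotientGroup.eq_one_iff]
    exact Subgroup.commutator_mem_commutator hx (Subgroup.mem_top y)
  have conj : ∀ g : G, ((g * a * g⁻¹ : G) : G ⧸ K) = ((⁅g, a⁆ : G) : G ⧸ K) * a := by
    intro g
    rw [← QuotientGroup.mk_mul, commutatorElement_def]
    simp
  have hc : ∀ g h : G, Commute ((g * a * g⁻¹ : G) : G ⧸ K) ((h * a * h⁻¹ : G) : G ⧸ K) := by
    intro g h
    rw [conj, conj]
    have hg : ⁅g, a⁆ ∈ ⁅(⊤ : Subgroup G), (⊤ : Subgroup G)⁆ :=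
      Subgroup.commutator_mem_commutator (Subgroup.mem_top _) (Subgroup.mem_top _)
    have hh : ⁅h, a⁆ ∈ ⁅(⊤ : Subgroup G), (⊤ : Subgroup G)⁆ :=
      Subgroup.commutator_mem_commutator (Subgroup.mem_top _) (Subgroup.mem_top _)
    exact ((key _ hg _).mul_right (key _ hg _)).mul_left
      ((key _ hh _).symm.mul_right (Commute.refl _))
  rw [Subgroup.commutator_le]
  intro x hx y hy
  rw [← QuotientGroup.eq_one_iff]
  change ⁅(x : G ⧸ K), (y : G ⧸ K)⁆ = 1
  rw [commutatorElement_eq_one_iff_commute]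
  unfold Subgroup.normalClosure at hx hy
  induction hx, hy using Subgroup.closure_induction₂ with
  | mem x y hx hy =>
    rw [Group.conjugatesOfSet, Set.biUnion_singleton] at hx hy
    obtain ⟨g, rfl⟩ := isConj_iff.1 hx
    obtain ⟨h, rfl⟩ := isConj_iff.1 hy
    exact hc g h
  | one_left x hx => exact Commute.one_left _
  | one_right x hx => exact Commute.one_right _
  | mul_left x y z hx hy hz h1 h2 => exact h1.mul_left h2
  | mul_right y z x hy hz hx h1 h2 => exact h1.mul_right h2
  | inv_left x y hx hy h => exact h.inv_left
  | inv_right x y hx hy h => exact h.inv_right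

theorem normalClosure_lowerCentralSeries {G : Type u} [Group G] (a : G) (n : ℕ)
    (h : (⊤ : Subgroup G).lowerCentralSeries (n + 2) = ⊥) :
    (⊤ : Subgroup (Subgroup.normalClosure {a})).lowerCentralSeries (n + 1) = ⊥ := by
  have key : ∀ n, (Subgroup.normalClosure {a}).lowerCentralSeries (n + 1) ≤
      (⊤ : Subgroup G).lowerCentralSeries (n + 2) := by
    intro n
    induction n with
    | zero => exact commutator_normalClosure_le a
    | succ n ih => exact Subgroup.commutator_mono ih le_top
  rw [← Subgroup.map_subtype_inj, Subgroup.map_bot, Subgroup.top_subtype_lowerCentralSeries]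
  exact le_bot_iff.1 ((key n).trans h.le)

theorem commute_of_lowerCentralSeries_one {G : Type u} [Group G]
    (h : (⊤ : Subgroup G).lowerCentralSeries 1 = ⊥) (x y : G) : Commute x y := by
  rw [← commutatorElement_eq_one_iff_commute, ← Subgroup.mem_bot, ← h]
  exact Subgroup.commutator_mem_commutator (Subgroup.mem_top _) (Subgroup.mem_top _)

theorem isOfFinOrder_mul_aux (n : ℕ) : ∀ (G : Type u) [Group G],
    (⊤ : Subgroup G).lowerCentralSeries (n + 1) = ⊥ →
    ∀ a b : G, IsOfFinOrder a → IsOfFinOrder b → IsOfFinOrder (a * b) := by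
  induction n with
  | zero =>
    intro G _ h a b ha hb
    exact (commute_of_lowerCentralSeries_one h a b).isOfFinOrder_mul ha hb
  | succ n ih =>
    intro G _ h a b ha hb
    let H := Subgroup.normalClosure {a}
    have hH := ih H (normalClosure_lowerCentralSeries a n h)
    have haH : a ∈ H := Subgroup.subset_normalClosure rfl
    have key : ∀ m : ℕ, ∃ t : H, IsOfFinOrder t ∧ (a * b) ^ m = t * b ^ m := by
      intro m
      induction m with
      | zero => exact ⟨1, IsOfFinOrder.one, by simp⟩
      | succ m ihm =>
        obtain ⟨t, ht, e⟩ := ihm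
        let c : H := ⟨b ^ m * a * (b ^ m)⁻¹,
          Subgroup.normalClosure_normal.conj_mem a haH (b ^ m)⟩
        have hc : IsOfFinOrder c := by
          rw [← Submonoid.isOfFinOrder_coe (H := H.toSubmonoid)]
          change IsOfFinOrder (b ^ m * a * (b ^ m)⁻¹)
          exact (isConj_iff.2 ⟨b ^ m, rfl⟩ : IsConj a _).isOfFinOrder ha
        refine ⟨t * c, hH t c ht hc, ?_⟩
        rw [pow_succ, e, pow_succ b]
        simp only [Subgroup.coe_mul, c]
        group
    obtain ⟨m, hm, hbm⟩ := isOfFinOrder_iff_pow_eq_one.1 hb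
    obtain ⟨t, ht, e⟩ := key m
    rw [hbm, mul_one] at e
    obtain ⟨l, hl, htl⟩ := isOfFinOrder_iff_pow_eq_one.1 ht
    refine isOfFinOrder_iff_pow_eq_one.2 ⟨m * l, Nat.mul_pos hm hl, ?_⟩
    rw [pow_mul, e, ← Subgroup.coe_pow, htl, Subgroup.coe_one]

theorem isOfFinOrder_mul_of_lcs (n : ℕ) {G : Type u} [Group G]
    (h : (⊤ : Subgroup G).lowerCentralSeries n = ⊥) {a b : G}
    (ha : IsOfFinOrder a) (hb : IsOfFinOrder b) : IsOfFinOrder (a * b) :=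
  isOfFinOrder_mul_aux n G
    (le_bot_iff.1 ((Subgroup.lowerCentralSeries_antitone _ n.le_succ).trans h.le)) a b ha hb

theorem isOfFinOrder_commutator_aux (n : ℕ) : ∀ (G : Type u) [Group G],
    (⊤ : Subgroup G).lowerCentralSeries (n + 1) = ⊥ →
    ∀ (x y : G) (m : ℕ), 0 < m → Commute (x ^ m) y → IsOfFinOrder ⁅x, y⁆ := by
  induction n with
  | zero =>
    intro G _ h x y m hm _
    rw [commutatorElement_eq_one_iff_commute.2 (commute_of_lowerCentralSeries_one h x y)]
    exact IsOfFinOrder.one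
  | succ n ih =>
    intro G _ h x y m hm hxy
    let H := Subgroup.normalClosure {x}
    have hH := ih H (normalClosure_lowerCentralSeries x n h)
    have hxH : x ∈ H := Subgroup.subset_normalClosure rfl
    let z := y * x * y⁻¹
    have hzH : z ∈ H := Subgroup.normalClosure_normal.conj_mem x hxH y
    have hz : z ^ m = x ^ m := by
      rw [conj_pow, ← hxy.eq, mul_inv_cancel_right]
    have h1 : IsOfFinOrder ⁅(⟨x, hxH⟩ : H), (⟨z, hzH⟩ : H)⁆ := by
      refine hH _ _ m hm ?_
      rw [commute_iff_eq]
      apply Subtype.ext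
      change x ^ m * z = z * x ^ m
      rw [← hz]
      exact (Commute.refl z).pow_left m
    have h2 : IsOfFinOrder ⁅x, z⁆ := by
      rw [← Submonoid.isOfFinOrder_coe (H := H.toSubmonoid)] at h1
      exact h1
    let T : Subgroup G :=
      { carrier := {g | IsOfFinOrder g}
        mul_mem' := fun ha hb => isOfFinOrder_mul_of_lcs _ h ha hb
        one_mem' := IsOfFinOrder.one
        inv_mem' := fun ha => IsOfFinOrder.inv ha }
    have hT : T.Normal :=
      ⟨fun a ha g => (isConj_iff.2 ⟨g, rfl⟩ : IsConj a _).isOfFinOrder ha⟩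
    have h3 : Commute (x : G ⧸ T) (z : G ⧸ T) := by
      rw [← commutatorElement_eq_one_iff_commute]
      change ((⁅x, z⁆ : G) : G ⧸ T) = 1
      rw [QuotientGroup.eq_one_iff]
      exact h2
    have h4 : (x * z⁻¹) ^ m ∈ T := by
      rw [← QuotientGroup.eq_one_iff, QuotientGroup.mk_pow, QuotientGroup.mk_mul,
        QuotientGroup.mk_inv, h3.inv_right.mul_pow, inv_pow, ← QuotientGroup.mk_pow,
        ← QuotientGroup.mk_pow, hz, mul_inv_cancel]
    have h5 : IsOfFinOrder (x * z⁻¹) := IsOfFinOrder.of_pow h4 hm.ne'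
    have h6 : ⁅x, y⁆ = x * z⁻¹ := by
      simp only [z, commutatorElement_def]; group
    rw [h6]; exact h5

/-- The lower central series `G_1 = G`, `G_{i+1} = [G_i, G]`, indexed from `1` (and `G_0 = G`). -/
def lcs (G : Type u) [Group G] (i : ℕ) : Subgroup G :=
  (⊤ : Subgroup G).lowerCentralSeries (i - 1)

instance lcs_normal (G : Type u) [Group G] (i : ℕ) : (lcs G i).Normal := by
  unfold lcs; infer_instance

theorem lcs_succ_le (G : Type u) [Group G] (i : ℕ) : lcs G (i + 1) ≤ lcs G i :=
  Subgroup.lowerCentralSeries_antitone _ (by omega)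

theorem quotient_lcs_eq_bot (G : Type u) [Group G] (i : ℕ) :
    (⊤ : Subgroup (G ⧸ lcs G i)).lowerCentralSeries (i - 1) = ⊥ := by
  have h : (⊤ : Subgroup (G ⧸ lcs G i)) = (⊤ : Subgroup G).map (QuotientGroup.mk' (lcs G i)) :=
    (Subgroup.map_top_of_surjective _ (QuotientGroup.mk'_surjective _)).symm
  rw [h, ← Subgroup.map_lowerCentralSeries, Subgroup.map_eq_bot_iff, QuotientGroup.ker_mk']
  exact le_refl _

theorem isOfFinOrder_mk_iff (G : Type u) [Group G] (i : ℕ) (c : G) :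
    IsOfFinOrder (c : G ⧸ lcs G i) ↔ ∃ n : ℕ, 0 < n ∧ c ^ n ∈ lcs G i := by
  simp only [isOfFinOrder_iff_pow_eq_one, ← QuotientGroup.mk_pow, QuotientGroup.eq_one_iff]

/-- The generalised commutator subgroup: all `c` with some positive power in `G_i`. -/
def genComm (G : Type u) [Group G] (i : ℕ) : Subgroup G where
  carrier := {c | ∃ n : ℕ, 0 < n ∧ c ^ n ∈ lcs G i}
  mul_mem' := by
    intro a b ha hb
    simp only [Set.mem_ofPred_eq, ← isOfFinOrder_mk_iff] at ha hb ⊢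
    exact isOfFinOrder_mul_of_lcs _ (quotient_lcs_eq_bot G i) ha hb
  one_mem' := ⟨1, one_pos, by simp [one_mem]⟩
  inv_mem' := by
    rintro a ⟨n, hn, h⟩
    exact ⟨n, hn, by simpa using h⟩

theorem mem_genComm {G : Type u} [Group G] {i : ℕ} {c : G} :
    c ∈ genComm G i ↔ ∃ n : ℕ, 0 < n ∧ c ^ n ∈ lcs G i := Iff.rfl

instance genComm_normal (G : Type u) [Group G] (i : ℕ) : (genComm G i).Normal where
  conj_mem := by
    rintro a ⟨n, hn, h⟩ g
    exact ⟨n, hn, by rw [conj_pow]; exact (lcs_normal G i).conj_mem _ h g⟩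

theorem genComm_succ_le (G : Type u) [Group G] (i : ℕ) : genComm G (i + 1) ≤ genComm G i := by
  rintro a ⟨n, hn, h⟩
  exact ⟨n, hn, lcs_succ_le G i h⟩

theorem commutator_mem_genComm {G : Type u} [Group G] {i : ℕ} {x : G} (hx : x ∈ genComm G i)
    (y : G) : ⁅x, y⁆ ∈ genComm G (i + 1) := by
  obtain ⟨n, hn, h⟩ := hx
  rw [mem_genComm, ← isOfFinOrder_mk_iff]
  have hnil := quotient_lcs_eq_bot G (i + 1)
  have hnil' := le_bot_iff.1
    ((Subgroup.lowerCentralSeries_antitone _ (Nat.le_succ (i + 1 - 1))).trans hnil.le)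
  refine isOfFinOrder_commutator_aux _ _ hnil' (x : G ⧸ lcs G (i + 1)) y n hn ?_
  rw [← commutatorElement_eq_one_iff_commute]
  change ((⁅x ^ n, y⁆ : G) : G ⧸ lcs G (i + 1)) = 1
  rw [QuotientGroup.eq_one_iff]
  rcases i with _ | i
  · exact Subgroup.mem_top _
  · exact Subgroup.commutator_mem_commutator h (Subgroup.mem_top y)

/-- The successive quotient `Ḡ_i / Ḡ_{i+1}`, written additively. -/
def GradedPiece (G : Type u) [Group G] (i : ℕ) : Type u :=
  Additive (genComm G i ⧸ (genComm G (i + 1)).subgroupOf (genComm G i))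

instance (G : Type u) [Group G] (i : ℕ) : AddCommGroup (GradedPiece G i) :=
  { (inferInstance : AddGroup (Additive
      (genComm G i ⧸ (genComm G (i + 1)).subgroupOf (genComm G i)))) with
    add_comm := by
      intro a b
      induction a using QuotientGroup.induction_on with | _ x
      induction b using QuotientGroup.induction_on with | _ y
      have : Commute (x : genComm G i ⧸ (genComm G (i + 1)).subgroupOf (genComm G i)) y := by
        rw [← commutatorElement_eq_one_iff_commute]
        change ((⁅x, y⁆ : genComm G i) : _ ⧸ (genComm G (i + 1)).subgroupOf (genComm G i)) = 1
        rw [QuotientGroup.eq_one_iff, Subgroup.mem_subgroupOf]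
        exact commutator_mem_genComm x.2 y
      exact this.eq }

/-- The rank `d_i` of `Ḡ_i / Ḡ_{i+1}`. -/
noncomputable def rk (G : Type u) [Group G] (i : ℕ) : ℕ := Module.finrank ℤ (GradedPiece G i)

/-- `n_k = d_1 + ⋯ + d_k`. -/
noncomputable def cumRk (G : Type u) [Group G] (k : ℕ) : ℕ := ∑ i ∈ Finset.Icc 1 k, rk G i

theorem cumRk_succ (G : Type u) [Group G] (k : ℕ) :
    cumRk G (k + 1) = cumRk G k + rk G (k + 1) :=
  Finset.sum_Icc_succ_top (by omega) _

theorem cumRk_mono (G : Type u) [Group G] : Monotone (cumRk G) :=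
  monotone_nat_of_le_succ fun k => by rw [cumRk_succ]; omega

/-- The image in `Ḡ_i / Ḡ_{i+1}` of an element of `Ḡ_i`. -/
def gradedClass {G : Type u} [Group G] {i : ℕ} (x : genComm G i) : GradedPiece G i :=
  Additive.ofMul (QuotientGroup.mk x)

theorem gradedClass_mul {G : Type u} [Group G] {i : ℕ} (x y : genComm G i) :
    gradedClass (x * y) = gradedClass x + gradedClass y := rfl

theorem gradedClass_zpow {G : Type u} [Group G] {i : ℕ} (x : genComm G i) (m : ℤ) :
    gradedClass (x ^ m) = m • gradedClass x :=
  map_zpow (QuotientGroup.mk' ((genComm G (i + 1)).subgroupOf (genComm G i))) x m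

theorem gradedClass_eq_iff {G : Type u} [Group G] {i : ℕ} (x y : genComm G i) :
    gradedClass x = gradedClass y ↔ (x : G)⁻¹ * y ∈ genComm G (i + 1) :=
  QuotientGroup.eq

/-- A coordinate system. The sequence is indexed from `0`: what is usually called `e_{j+1}` is
`e j`. For each `i ≥ 1` the elements `e_{n_{i-1}+1}, …, e_{n_i}` lie in `Ḡ_i` and their images form
a basis of the abelian group `Ḡ_i / Ḡ_{i+1}`. If the ranks `d_i` vanish from some point on, the
sequence is really finite: the entries `e j` with `j ≥ n_k` for all `k` are irrelevant, and nothing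
below depends on them. -/
structure CoordinateSystem (G : Type u) [Group G] where
  e : ℕ → G
  mem : ∀ (i : ℕ) (t : Fin (rk G (i + 1))), e (cumRk G i + t) ∈ genComm G (i + 1)
  linearIndependent : ∀ i : ℕ, LinearIndependent ℤ
    fun t : Fin (rk G (i + 1)) => gradedClass ⟨e (cumRk G i + t), mem i t⟩
  span_eq_top : ∀ i : ℕ, Submodule.span ℤ (Set.range
    fun t : Fin (rk G (i + 1)) => gradedClass ⟨e (cumRk G i + t), mem i t⟩) = ⊤

namespace CoordinateSystem

variable {G : Type u} [Group G] (E : CoordinateSystem G)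

/-- The ordered product `e_1^{c_1} ⋯ e_{n_k}^{c_{n_k}}`. -/
noncomputable def word (k : ℕ) (c : ℕ → ℤ) : G :=
  ((List.range (cumRk G k)).map fun j => E.e j ^ c j).prod

/-- `c` is the sequence of coordinates of `x`: for every `k`,
`x Ḡ_{k+1} = e_1^{c_1} ⋯ e_{n_k}^{c_{n_k}} Ḡ_{k+1}`. The sequence of coordinates is finite if the
coordinate system is, and is then continued by zeros. -/
def IsCoordinates (x : G) (c : ℕ → ℤ) : Prop :=
  (∀ k : ℕ, (x : G ⧸ genComm G (k + 1)) = (E.word k c : G)) ∧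
    ∀ j : ℕ, (∀ k : ℕ, cumRk G k ≤ j) → c j = 0

theorem word_congr {k : ℕ} {c c' : ℕ → ℤ} (h : ∀ j < cumRk G k, c j = c' j) :
    E.word k c = E.word k c' := by
  unfold word
  congr 1
  refine List.map_congr_left fun j hj => ?_
  rw [h j (List.mem_range.1 hj)]

theorem block_aux (k : ℕ) (c : ℕ → ℤ) (l : List (Fin (rk G (k + 1)))) :
    ∃ h : (l.map fun t : Fin (rk G (k + 1)) => E.e (cumRk G k + t) ^ c (cumRk G k + t)).prod ∈ genComm G (k + 1),
      gradedClass ⟨_, h⟩ = (l.map fun t : Fin (rk G (k + 1)) => c (cumRk G k + t) •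
        gradedClass ⟨E.e (cumRk G k + t), E.mem k t⟩).sum := by
  induction l with
  | nil => exact ⟨one_mem _, rfl⟩
  | cons t l ih =>
    obtain ⟨h, e⟩ := ih
    refine ⟨?_, ?_⟩
    · rw [List.map_cons, List.prod_cons]
      exact mul_mem (zpow_mem (E.mem k t) _) h
    · simp only [List.map_cons, List.prod_cons, List.sum_cons]
      rw [← e, ← gradedClass_zpow, ← gradedClass_mul]
      rfl

theorem word_succ (k : ℕ) (c : ℕ → ℤ) :
    ∃ b : genComm G (k + 1), E.word (k + 1) c = E.word k c * b ∧
      gradedClass b = ∑ t : Fin (rk G (k + 1)), c (cumRk G k + t) •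
        gradedClass ⟨E.e (cumRk G k + t), E.mem k t⟩ := by
  obtain ⟨h, e⟩ := E.block_aux k c (List.finRange _)
  refine ⟨⟨_, h⟩, ?_, ?_⟩
  · unfold word
    rw [cumRk_succ, List.range_add, List.map_append, List.prod_append,
      ← List.map_coe_finRange_eq_range (n := rk G (k + 1))]
    simp only [List.map_map]
    rfl
  · rw [e, Fin.sum_univ_def]

theorem isCoordinates_unique {x : G} {c c' : ℕ → ℤ} (h : E.IsCoordinates x c)
    (h' : E.IsCoordinates x c') : c = c' := by
  have key : ∀ k, ∀ j < cumRk G k, c j = c' j := by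
    intro k
    induction k with
    | zero => intro j hj; simp [cumRk] at hj
    | succ k ih =>
      obtain ⟨b, hb, eb⟩ := E.word_succ k c
      obtain ⟨b', hb', eb'⟩ := E.word_succ k c'
      have h1 := (h.1 (k + 1)).symm.trans (h'.1 (k + 1))
      rw [hb, hb', E.word_congr ih, QuotientGroup.eq] at h1
      have h2 : gradedClass b = gradedClass b' := by
        rw [gradedClass_eq_iff]
        simpa [mul_assoc] using h1
      rw [eb, eb', ← sub_eq_zero, ← Finset.sum_sub_distrib] at h2
      simp only [← sub_smul] at h2
      have h3 := Fintype.linearIndependent_iff.1 (E.linearIndependent k) _ h2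
      intro j hj
      rcases lt_or_ge j (cumRk G k) with hlt | hge
      · exact ih j hlt
      · rw [cumRk_succ] at hj
        have := h3 ⟨j - cumRk G k, by omega⟩
        simp only [Nat.add_sub_cancel' hge] at this
        exact sub_eq_zero.1 this
  funext j
  by_cases hj : ∃ k, j < cumRk G k
  · obtain ⟨k, hk⟩ := hj
    exact key k j hk
  · push Not at hj
    rw [h.2 j hj, h'.2 j hj]

theorem exists_step (x : G) (k : ℕ) (c : ℕ → ℤ)
    (h : (x : G ⧸ genComm G (k + 1)) = (E.word k c : G)) :
    ∃ c' : ℕ → ℤ, (∀ j < cumRk G k, c' j = c j) ∧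
      (x : G ⧸ genComm G (k + 2)) = (E.word (k + 1) c' : G) := by
  let g : genComm G (k + 1) := ⟨(E.word k c)⁻¹ * x, QuotientGroup.eq.1 h.symm⟩
  have hg : gradedClass g ∈ (⊤ : Submodule ℤ (GradedPiece G (k + 1))) := Submodule.mem_top
  rw [← E.span_eq_top k, Submodule.mem_span_range_iff_exists_fun] at hg
  obtain ⟨r, hr⟩ := hg
  let c' : ℕ → ℤ := fun j => if j < cumRk G k then c j else
    if hj : j - cumRk G k < rk G (k + 1) then r ⟨j - cumRk G k, hj⟩ else 0
  have h1 : ∀ j < cumRk G k, c' j = c j := fun j hj => if_pos hj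
  have h2 : ∀ t : Fin (rk G (k + 1)), c' (cumRk G k + t) = r t := by
    intro t
    simp [c']
  obtain ⟨b, hb, eb⟩ := E.word_succ k c'
  refine ⟨c', h1, ?_⟩
  simp only [h2] at eb
  have h3 := (gradedClass_eq_iff b g).1 (eb.trans hr)
  rw [hb, E.word_congr h1, eq_comm, QuotientGroup.eq]
  simpa [g, mul_assoc] using h3

theorem exists_isCoordinates (x : G) : ∃ c, E.IsCoordinates x c := by
  choose! F hF1 hF2 using E.exists_step x
  let C : ℕ → ℕ → ℤ := fun k => Nat.rec (fun _ => 0) (fun k c => F k c) k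
  have hC : ∀ k, (x : G ⧸ genComm G (k + 1)) = (E.word k (C k) : G) := by
    intro k
    induction k with
    | zero =>
      rw [QuotientGroup.eq]
      exact ⟨1, one_pos, Subgroup.mem_top _⟩
    | succ k ih => exact hF2 k (C k) ih
  have hmono : ∀ k m, k ≤ m → ∀ j < cumRk G k, C m j = C k j := by
    intro k m hkm
    induction m, hkm using Nat.le_induction with
    | base => intro j _; rfl
    | succ m hm ih =>
      intro j hj
      rw [← ih j hj]
      exact hF1 m (C m) (hC m) j (hj.trans_le (cumRk_mono G hm))
  classical
  let c : ℕ → ℤ := fun j => if h : ∃ k, j < cumRk G k then C (Nat.find h) j else 0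
  refine ⟨c, fun k => ?_, fun j hj => dif_neg (by push Not; exact hj)⟩
  rw [hC k]
  congr 1
  refine E.word_congr fun j hj => ?_
  have h : ∃ k, j < cumRk G k := ⟨k, hj⟩
  have : c j = C (Nat.find h) j := dif_pos h
  rw [this]
  exact hmono _ _ (Nat.find_min' h hj) j (Nat.find_spec h)

/-- The coordinates of `x`. The usual `x_{j+1}` is `E.coord x j`. -/
noncomputable def coord (x : G) : ℕ → ℤ := (E.exists_isCoordinates x).choose

theorem coord_spec (x : G) : E.IsCoordinates x (E.coord x) :=
  (E.exists_isCoordinates x).choose_spec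

theorem isCoordinates_iff (x : G) (c : ℕ → ℤ) : E.IsCoordinates x c ↔ c = E.coord x :=
  ⟨fun h => E.isCoordinates_unique h (E.coord_spec x), fun h => h ▸ E.coord_spec x⟩

/-- The weight `σ(j) = sup {k : e_j ∈ Ḡ_k}`. -/
noncomputable def weight (j : ℕ) : ℕ := sSup {k : ℕ | E.e j ∈ genComm G k}

/-- The data of a coordinate monomial `λ x_1^{a_1} ⋯ x_r^{a_r}`, where `r ≤ n_k` for some `k`. -/
structure Monomial (E : CoordinateSystem G) where
  coeff : ℂ
  r : ℕ
  exists_le : ∃ k : ℕ, r ≤ cumRk G k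
  a : Fin r → ℕ

/-- The function on `G` defined by a coordinate monomial. -/
noncomputable def Monomial.eval {E : CoordinateSystem G} (q : E.Monomial) (x : G) : ℂ :=
  q.coeff * ∏ i : Fin q.r, (E.coord x i : ℂ) ^ q.a i

/-- The degree `σ(1) a_1 + ⋯ + σ(r) a_r` of a coordinate monomial. -/
noncomputable def Monomial.degree {E : CoordinateSystem G} (q : E.Monomial) : ℕ :=
  ∑ i : Fin q.r, E.weight i * q.a i

/-- `f` is a coordinate polynomial of degree at most `k`: a finite sum of coordinate monomials, each
of degree at most `k`. (The empty sum is the zero function.) -/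
def IsCoordPolyOfDegreeLE (k : ℤ) (f : G → ℂ) : Prop :=
  ∃ (t : ℕ) (q : Fin t → E.Monomial),
    (∀ s, ((q s).degree : ℤ) ≤ k) ∧ ∀ x, f x = ∑ s, (q s).eval x

end CoordinateSystem

/-- The left derivative `∂_u f (x) = f (u x) - f x`. -/
def leftDeriv {G : Type u} [Group G] (u : G) (f : G → ℂ) : G → ℂ := fun x => f (u * x) - f x

/-- `iterDeriv [u_1, …, u_m] f = ∂_{u_1} ⋯ ∂_{u_m} f`. -/
def iterDeriv {G : Type u} [Group G] (us : List G) (f : G → ℂ) : G → ℂ := us.foldr leftDeriv f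

theorem iterDeriv_add {G : Type u} [Group G] (us : List G) (f g : G → ℂ) :
    iterDeriv us (f + g) = iterDeriv us f + iterDeriv us g := by
  induction us with
  | nil => rfl
  | cons u us ih =>
    change leftDeriv u (iterDeriv us (f + g)) =
      leftDeriv u (iterDeriv us f) + leftDeriv u (iterDeriv us g)
    rw [ih]; funext x; simp only [leftDeriv, Pi.add_apply]; ring

theorem iterDeriv_smul {G : Type u} [Group G] (us : List G) (z : ℂ) (f : G → ℂ) :
    iterDeriv us (z • f) = z • iterDeriv us f := by
  induction us with
  | nil => rfl
  | cons u us ih =>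
    change leftDeriv u (iterDeriv us (z • f)) = z • leftDeriv u (iterDeriv us f)
    rw [ih]; funext x; simp only [leftDeriv, Pi.smul_apply, smul_eq_mul]; ring

/-- The space of functions all of whose `m`-fold left derivatives vanish. -/
def derivKer (G : Type u) [Group G] (m : ℕ) : Submodule ℂ (G → ℂ) where
  carrier := {f | ∀ us : List G, us.length = m → iterDeriv us f = 0}
  add_mem' := fun {f g} hf hg us h => by rw [iterDeriv_add, hf us h, hg us h, add_zero]
  zero_mem' := fun us _ => by simpa using iterDeriv_smul us 0 (0 : G → ℂ)
  smul_mem' := fun z f hf us h => by rw [iterDeriv_smul, hf us h, smul_zero]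

/-- The space `P^k(G)` of polynomials of degree at most `k`: all functions `f` with
`∂_{u_1} ⋯ ∂_{u_{k+1}} f = 0` for all `u_1, …, u_{k+1}` if `k ≥ 0`, and `{0}` if `k < 0`. -/
def polySpace (G : Type u) [Group G] : ℤ → Submodule ℂ (G → ℂ)
  | Int.ofNat k => derivKer G (k + 1)
  | Int.negSucc _ => ⊥

end GroupPoly

namespace GroupPoly

universe u

/-! Both directions rest on the filtration $\overline G_1\supseteq\overline G_2\supseteq\cdots$
being strongly central, $[\overline G_s,\overline G_t]\le\overline G_{s+t}$
(`commutator_mem_genComm_add`). Throughout, `derivKer G m` is the space of polynomials of degree at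
most $m-1$.

Coordinate polynomials are polynomials. By the Leibniz rule it suffices that each coordinate $x_j$
has degree at most $\sigma(j)$ (`coord_mem_derivKer`). Call $g:G\to G$ polynomial of level $t$ if
its $r$-fold multiplicative derivatives take values in $\overline G_{t+r}$. As in Lazard and
Leibman, such maps form a group (`mul_inv_commutator`). If the coordinates of weight at most $K$
have the right degrees, then $x\mapsto e_1^{x_1}\cdots e_{n_K}^{x_{n_K}}$ is polynomial of level
$0$, and so is the remainder $b(x)=(e_1^{x_1}\cdots e_{n_K}^{x_{n_K}})^{-1}x\in\overline G_{K+1}$.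
The next block of coordinates is obtained from $b$ by homomorphisms $\overline G_{K+1}/\overline
G_{K+2}\to\mathbb Z$, which turn multiplicative derivatives into additive ones.

Polynomials are coordinate polynomials. For $u\in\overline G_i$ the operator $\partial_u$ lowers
degree by $i$ (`genComm_le_derivLowering`). Hence $f\in P^k(G)$ is constant on cosets of $\overline
G_{k+1}$, and $x$ may be replaced by its word $e_1^{x_1}\cdots e_{n_k}^{x_{n_k}}$. Newton's formula
$f(e^ny)=\sum_a\binom na\,\partial_e^af(y)$ (`apply_zpow_mul_eq_sum`) strips off one factor at a
time; $\binom{x_j}{a}$ contributes degree $\sigma(j)a$, exactly what $\partial_{e_j}^a$ removes. -/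

/-! ### Commutators of the subgroups $\overline G_i$. -/

/-- The three subgroups lemma in the quotient by $N$. -/
theorem commutator_le_of_rotate {G : Type u} [Group G] {A B C N : Subgroup G} [N.Normal]
    (h1 : ⁅⁅B, C⁆, A⁆ ≤ N) (h2 : ⁅⁅C, A⁆, B⁆ ≤ N) : ⁅⁅A, B⁆, C⁆ ≤ N := by
  have key : ∀ K : Subgroup G, K ≤ N ↔ K.map (QuotientGroup.mk' N) = ⊥ := fun K => by
    rw [Subgroup.map_eq_bot_iff, QuotientGroup.ker_mk']
  rw [key] at h1 h2 ⊢
  simp only [Subgroup.map_commutator] at h1 h2 ⊢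
  exact Subgroup.commutator_commutator_eq_bot_of_rotate h1 h2

theorem commutator_lowerCentralSeries_le (G : Type u) [Group G] (m : ℕ) : ∀ n : ℕ,
    ⁅(⊤ : Subgroup G).lowerCentralSeries n, (⊤ : Subgroup G).lowerCentralSeries m⁆ ≤
      (⊤ : Subgroup G).lowerCentralSeries (n + m + 1) := by
  induction m with
  | zero => intro n; exact le_refl _
  | succ m ih =>
    intro n
    rw [Subgroup.commutator_comm, Subgroup.lowerCentralSeries_succ]
    refine commutator_le_of_rotate ?_ ?_
    · rw [Subgroup.commutator_comm ⊤]
      exact (ih (n + 1)).trans (Subgroup.lowerCentralSeries_antitone _ (by omega))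
    · exact Subgroup.commutator_mono (ih n) le_rfl

theorem commutator_lcs_le (G : Type u) [Group G] (s t : ℕ) :
    ⁅lcs G s, lcs G t⁆ ≤ lcs G (s + t) := by
  rcases Nat.eq_zero_or_pos s with rfl | hs
  · rw [zero_add]; exact Subgroup.commutator_le_right _ _
  rcases Nat.eq_zero_or_pos t with rfl | ht
  · exact Subgroup.commutator_le_left _ _
  refine (commutator_lowerCentralSeries_le G (t - 1) (s - 1)).trans ?_
  exact Subgroup.lowerCentralSeries_antitone _ (by omega)

theorem lcs_le_genComm (G : Type u) [Group G] (i : ℕ) : lcs G i ≤ genComm G i :=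
  fun x hx => ⟨1, one_pos, by simpa using hx⟩

theorem mem_genComm_of_pow_mem {G : Type u} [Group G] {i n : ℕ} {x : G} (hn : 0 < n)
    (h : x ^ n ∈ genComm G i) : x ∈ genComm G i := by
  obtain ⟨m, hm, h⟩ := h
  exact ⟨n * m, Nat.mul_pos hn hm, by rwa [pow_mul]⟩

/-- The quotient by $\overline G_i$ is nilpotent, so the commutator has finite order; it is also
torsion-free, so the commutator is trivial. -/
theorem commute_mk_of_commute_pow {G : Type u} [Group G] (i : ℕ) {n : ℕ} (hn : 0 < n) {x y : G}
    (h : Commute ((x : G ⧸ genComm G i) ^ n) y) : Commute (x : G ⧸ genComm G i) y := by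
  have hnil : (⊤ : Subgroup (G ⧸ genComm G i)).lowerCentralSeries (i - 1 + 1) = ⊥ := by
    have hmap : (⊤ : Subgroup (G ⧸ genComm G i)) =
        (⊤ : Subgroup G).map (QuotientGroup.mk' (genComm G i)) :=
      (Subgroup.map_top_of_surjective _ (QuotientGroup.mk'_surjective _)).symm
    rw [hmap, ← Subgroup.map_lowerCentralSeries, Subgroup.map_eq_bot_iff, QuotientGroup.ker_mk']
    exact (Subgroup.lowerCentralSeries_antitone _ (Nat.le_succ _)).trans (lcs_le_genComm G i)
  have hfin := isOfFinOrder_commutator_aux _ _ hnil (x : G ⧸ genComm G i) y n hn h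
  obtain ⟨m, hm, e⟩ := isOfFinOrder_iff_pow_eq_one.1 hfin
  rw [← commutatorElement_eq_one_iff_commute]
  change ((⁅x, y⁆ : G) : G ⧸ genComm G i) = 1
  change ((⁅x, y⁆ ^ m : G) : G ⧸ genComm G i) = 1 at e
  rw [QuotientGroup.eq_one_iff] at e ⊢
  exact mem_genComm_of_pow_mem hm e

/-- Suitable powers of $x$ and $y$ lie in the lower central series, where the inclusion is known;
the two exponents are then removed one at a time. -/
theorem commutator_mem_genComm_add {G : Type u} [Group G] {s t : ℕ} {x y : G}
    (hx : x ∈ genComm G s) (hy : y ∈ genComm G t) : ⁅x, y⁆ ∈ genComm G (s + t) := by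
  obtain ⟨n, hn, hx⟩ := hx
  obtain ⟨m, hm, hy⟩ := hy
  have h : Commute ((x ^ n : G) : G ⧸ genComm G (s + t)) ((y ^ m : G) : G ⧸ genComm G (s + t)) := by
    rw [← commutatorElement_eq_one_iff_commute]
    change ((⁅x ^ n, y ^ m⁆ : G) : G ⧸ genComm G (s + t)) = 1
    rw [QuotientGroup.eq_one_iff]
    exact lcs_le_genComm _ _ (commutator_lcs_le G s t (Subgroup.commutator_mem_commutator hx hy))
  have h1 := (commute_mk_of_commute_pow (s + t) hn h).symm
  have h2 := commute_mk_of_commute_pow (s + t) hm h1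
  rw [← QuotientGroup.eq_one_iff]
  change ⁅(x : G ⧸ genComm G (s + t)), (y : G ⧸ genComm G (s + t))⁆ = 1
  rw [commutatorElement_eq_one_iff_commute]
  exact h2.symm

theorem genComm_antitone (G : Type u) [Group G] : Antitone (genComm G) :=
  antitone_nat_of_succ_le (genComm_succ_le G)

theorem mem_genComm_one {G : Type u} [Group G] (x : G) : x ∈ genComm G 1 :=
  ⟨1, one_pos, Subgroup.mem_top _⟩

/-! ### Polynomial maps from $G$ to itself. -/

/-- The multiplicative derivative `x ↦ g (u x) g(x)⁻¹` of a map `g : G → G`. -/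
def mulDeriv {G : Type u} [Group G] (u : G) (g : G → G) : G → G := fun x => g (u * x) * (g x)⁻¹

/-- `IsPolyMap m t g` says that for `r ≤ m` the `r`-fold multiplicative derivatives of `g` take
values in `Ḡ_{t + r}`. -/
def IsPolyMap {G : Type u} [Group G] : ℕ → ℕ → (G → G) → Prop
  | 0, t, g => ∀ x, g x ∈ genComm G t
  | m + 1, t, g => (∀ x, g x ∈ genComm G t) ∧ ∀ u, IsPolyMap m (t + 1) (mulDeriv u g)

namespace IsPolyMap

variable {G : Type u} [Group G]

theorem mono_right {m : ℕ} : ∀ {s t : ℕ} {g : G → G}, IsPolyMap m t g → s ≤ t →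
    IsPolyMap m s g := by
  induction m with
  | zero => intro s t g h hst x; exact genComm_antitone G hst (h x)
  | succ m ih =>
    intro s t g h hst
    exact ⟨fun x => genComm_antitone G hst (h.1 x), fun u => ih (h.2 u) (by omega)⟩

theorem of_succ {m : ℕ} : ∀ {t : ℕ} {g : G → G}, IsPolyMap (m + 1) t g → IsPolyMap m t g := by
  induction m with
  | zero => intro t g h; exact h.1
  | succ m ih => intro t g h; exact ⟨h.1, fun u => ih (h.2 u)⟩

theorem one (m : ℕ) : ∀ t : ℕ, IsPolyMap m t (1 : G → G) := by
  induction m with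
  | zero => intro t x; exact one_mem _
  | succ m ih =>
    intro t
    refine ⟨fun x => one_mem _, fun u => ?_⟩
    have : mulDeriv u (1 : G → G) = 1 := by funext x; simp [mulDeriv]
    rw [this]; exact ih _

/-- The three closure properties need a simultaneous induction: the derivative of a product or an
inverse involves conjugates, hence commutators, and the derivative of a commutator involves all
three operations. -/
theorem mul_inv_commutator (m : ℕ) :
    (∀ (t : ℕ) (g h : G → G), IsPolyMap m t g → IsPolyMap m t h → IsPolyMap m t (g * h)) ∧
    (∀ (t : ℕ) (g : G → G), IsPolyMap m t g → IsPolyMap m t g⁻¹) ∧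
    (∀ (s t : ℕ) (g h : G → G), IsPolyMap m s g → IsPolyMap m t h →
      IsPolyMap m (s + t) ⁅g, h⁆) := by
  induction m with
  | zero =>
    exact ⟨fun t g h hg hh x => mul_mem (hg x) (hh x), fun t g hg x => inv_mem (hg x),
      fun s t g h hg hh x => commutator_mem_genComm_add (hg x) (hh x)⟩
  | succ m ih =>
    obtain ⟨hmul, hinv, hcomm⟩ := ih
    -- Since $ghg^{-1}=[g,h]h$, conjugation by a map of level $0$ preserves the level.
    have hconj : ∀ (t : ℕ) (g h : G → G), IsPolyMap m 0 g → IsPolyMap m t h →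
        IsPolyMap m t (g * h * g⁻¹) := by
      intro t g h hg hh
      have h1 := hcomm 0 t g h hg hh
      rw [zero_add] at h1
      have h2 := hmul t _ _ h1 hh
      have e : ⁅g, h⁆ * h = g * h * g⁻¹ := by rw [commutatorElement_def]; group
      rwa [e] at h2
    refine ⟨fun t g h hg hh => ⟨fun x => mul_mem (hg.1 x) (hh.1 x), fun u => ?_⟩,
      fun t g hg => ⟨fun x => inv_mem (hg.1 x), fun u => ?_⟩,
      fun s t g h hg hh => ⟨fun x => commutator_mem_genComm_add (hg.1 x) (hh.1 x), fun u => ?_⟩⟩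
    · have e : mulDeriv u (g * h) = mulDeriv u g * (g * mulDeriv u h * g⁻¹) := by
        funext x; simp only [mulDeriv, Pi.mul_apply, Pi.inv_apply]; group
      rw [e]
      exact hmul _ _ _ (hg.2 u) (hconj _ _ _ (hg.of_succ.mono_right (Nat.zero_le _)) (hh.2 u))
    · have e : mulDeriv u g⁻¹ = g⁻¹ * (mulDeriv u g)⁻¹ * (g⁻¹)⁻¹ := by
        funext x; simp only [mulDeriv, Pi.mul_apply, Pi.inv_apply]; group
      rw [e]
      exact hconj _ _ _ (hinv _ _ (hg.of_succ.mono_right (Nat.zero_le _))) (hinv _ _ (hg.2 u))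
    · set a := mulDeriv u g with ha
      set c := mulDeriv u h with hc
      have pa : IsPolyMap m (s + 1) a := hg.2 u
      have pc : IsPolyMap m (t + 1) c := hh.2 u
      have pg := hg.of_succ
      have ph := hh.of_succ
      -- With $a=\partial_ug$ and $c=\partial_uh$, the derivative of $[g,h]$ is $[ag,ch][g,h]^{-1}$.
      -- It must be trivial modulo the normal subgroup $N$ of maps of level $s+t+1$. There $a$
      -- commutes with $c$ and $h$, $c$ commutes with $g$, and both commute with $[g,h]$, because
      -- the levels add up to at least $s+t+1$.
      let P : Subgroup (G → G) :=
        { carrier := {f | IsPolyMap m 0 f}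
          mul_mem' := fun h1 h2 => hmul _ _ _ h1 h2
          one_mem' := one m 0
          inv_mem' := fun h1 => hinv _ _ h1 }
      let N : Subgroup P :=
        { carrier := {f | IsPolyMap m (s + t + 1) (f : G → G)}
          mul_mem' := fun h1 h2 => hmul _ _ _ h1 h2
          one_mem' := one m _
          inv_mem' := fun h1 => hinv _ _ h1 }
      have hN : N.Normal := ⟨fun f hf k => hconj _ _ _ k.2 hf⟩
      let a' : P := ⟨a, pa.mono_right (Nat.zero_le _)⟩
      let c' : P := ⟨c, pc.mono_right (Nat.zero_le _)⟩
      let g' : P := ⟨g, pg.mono_right (Nat.zero_le _)⟩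
      let h' : P := ⟨h, ph.mono_right (Nat.zero_le _)⟩
      have comm : ∀ f k : P, ∀ i j : ℕ, IsPolyMap m i (f : G → G) → IsPolyMap m j (k : G → G) →
          s + t + 1 ≤ i + j → Commute (f : P ⧸ N) (k : P ⧸ N) := by
        intro f k i j hf hk hij
        rw [← commutatorElement_eq_one_iff_commute]
        change ((⁅f, k⁆ : P) : P ⧸ N) = 1
        rw [QuotientGroup.eq_one_iff]
        exact (hcomm i j f k hf hk).mono_right hij
      have hac := comm a' c' _ _ pa pc (by omega)
      have hah := comm a' h' _ _ pa ph (by omega)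
      have hgc := comm g' c' _ _ pg pc (by omega)
      have pgh := hcomm s t g h pg ph
      have ha2 := comm a' ⁅g', h'⁆ _ _ pa pgh (by omega)
      have hc2 := comm c' ⁅g', h'⁆ _ _ pc pgh (by omega)
      have key : ((⁅a' * g', c' * h'⁆ * ⁅g', h'⁆⁻¹ : P) : P ⧸ N) = 1 := by
        change ⁅(a' : P ⧸ N) * g', (c' : P ⧸ N) * h'⁆ * ⁅(g' : P ⧸ N), (h' : P ⧸ N)⁆⁻¹ = 1
        change Commute (a' : P ⧸ N) ⁅(g' : P ⧸ N), (h' : P ⧸ N)⁆ at ha2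
        change Commute (c' : P ⧸ N) ⁅(g' : P ⧸ N), (h' : P ⧸ N)⁆ at hc2
        generalize (a' : P ⧸ N) = a at *
        generalize (c' : P ⧸ N) = c at *
        generalize (g' : P ⧸ N) = g at *
        generalize (h' : P ⧸ N) = h at *
        rw [mul_inv_eq_one]
        have e : ⁅a * g, c * h⁆ = (c * a) * ⁅g, h⁆ * (c * a)⁻¹ := by
          calc ⁅a * g, c * h⁆ = a * (g * c) * h * g⁻¹ * (a⁻¹ * h⁻¹) * c⁻¹ := by
                rw [commutatorElement_def]; group
            _ = a * c * g * h * g⁻¹ * h⁻¹ * (a⁻¹ * c⁻¹) := by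
                rw [hgc.eq, (hah.inv_inv).eq]; group
            _ = (c * a) * ⁅g, h⁆ * (c * a)⁻¹ := by
                rw [hac.eq, commutatorElement_def]; group
        rw [e, (hc2.mul_left ha2).eq, mul_inv_cancel_right]
      rw [QuotientGroup.eq_one_iff] at key
      have e : mulDeriv u ⁅g, h⁆ = ⁅a * g, c * h⁆ * ⁅g, h⁆⁻¹ := by
        have e1 : a * g = fun x => g (u * x) := by funext x; simp [ha, mulDeriv]
        have e2 : c * h = fun x => h (u * x) := by funext x; simp [hc, mulDeriv]
        rw [e1, e2]; rfl
      rw [e]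
      exact key

theorem mul {m t : ℕ} {g h : G → G} (hg : IsPolyMap m t g) (hh : IsPolyMap m t h) :
    IsPolyMap m t (g * h) := (mul_inv_commutator m).1 t g h hg hh

theorem inv {m t : ℕ} {g : G → G} (hg : IsPolyMap m t g) : IsPolyMap m t g⁻¹ :=
  (mul_inv_commutator m).2.1 t g hg

theorem const {u : G} {t : ℕ} (hu : u ∈ genComm G t) (m : ℕ) : IsPolyMap m t fun _ => u := by
  cases m with
  | zero => exact fun _ => hu
  | succ m =>
    refine ⟨fun _ => hu, fun v => ?_⟩
    have : mulDeriv v (fun _ : G => u) = 1 := by funext x; simp [mulDeriv]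
    rw [this]; exact one _ _

theorem id (m : ℕ) : IsPolyMap m 0 (fun x : G => x) := by
  have h0 : ∀ x : G, x ∈ genComm G 0 := fun x => genComm_succ_le G 0 (mem_genComm_one x)
  cases m with
  | zero => exact h0
  | succ m =>
    refine ⟨h0, fun u => ?_⟩
    have : mulDeriv u (fun x : G => x) = fun _ => u := by funext x; simp [mulDeriv]
    rw [this]; exact const (mem_genComm_one u) m

theorem list_prod {ι : Type*} {m t : ℕ} (g : ι → G → G) (l : List ι)
    (h : ∀ j ∈ l, IsPolyMap m t (g j)) : IsPolyMap m t fun x => (l.map fun j => g j x).prod := by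
  induction l with
  | nil => exact one m t
  | cons j l ih =>
    simp only [List.map_cons, List.prod_cons]
    exact (h j (by simp)).mul (ih fun i hi => h i (by simp [hi]))

end IsPolyMap

/-! ### Complex-valued polynomials and the Leibniz rule. -/

theorem mem_derivKer_zero {G : Type u} [Group G] {f : G → ℂ} : f ∈ derivKer G 0 ↔ f = 0 := by
  constructor
  · intro h; exact h [] rfl
  · rintro rfl; exact zero_mem _

theorem iterDeriv_append {G : Type u} [Group G] (us vs : List G) (f : G → ℂ) :
    iterDeriv (us ++ vs) f = iterDeriv us (iterDeriv vs f) := by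
  simp [iterDeriv, List.foldr_append]

theorem mem_derivKer_succ {G : Type u} [Group G] {d : ℕ} {f : G → ℂ} :
    f ∈ derivKer G (d + 1) ↔ ∀ u, leftDeriv u f ∈ derivKer G d := by
  constructor
  · intro h u us hus
    have := h (us ++ [u]) (by simp [hus])
    rwa [iterDeriv_append] at this
  · intro h us hus
    obtain ⟨vs, u, rfl⟩ := List.eq_nil_or_concat' us |>.resolve_left (by rintro rfl; simp at hus)
    rw [iterDeriv_append]
    exact h u vs (by simpa using hus)

theorem derivKer_le_succ (G : Type u) [Group G] (d : ℕ) : derivKer G d ≤ derivKer G (d + 1) := by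
  induction d with
  | zero =>
    intro f hf
    rw [mem_derivKer_zero] at hf
    rw [hf]; exact zero_mem _
  | succ d ih =>
    intro f hf
    rw [mem_derivKer_succ] at hf ⊢
    exact fun u => ih (hf u)

theorem derivKer_mono (G : Type u) [Group G] : Monotone (derivKer G) :=
  monotone_nat_of_le_succ (derivKer_le_succ G)

theorem comp_mul_left_mem_derivKer {G : Type u} [Group G] {d : ℕ} {f : G → ℂ}
    (hf : f ∈ derivKer G d) (v : G) : (fun x => f (v * x)) ∈ derivKer G d := by
  have h : leftDeriv v f ∈ derivKer G d := mem_derivKer_succ.1 (derivKer_le_succ G d hf) v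
  have e : (fun x => f (v * x)) = leftDeriv v f + f := by funext x; simp [leftDeriv]
  rw [e]; exact add_mem h hf

theorem mul_mem_derivKer {G : Type u} [Group G] (n : ℕ) : ∀ (a b : ℕ) (f g : G → ℂ), a + b = n →
    f ∈ derivKer G (a + 1) → g ∈ derivKer G (b + 1) → f * g ∈ derivKer G (a + b + 1) := by
  induction n using Nat.strong_induction_on with
  | _ n ih =>
    intro a b f g hab hf hg
    rw [mem_derivKer_succ]
    intro u
    have e : leftDeriv u (f * g) = leftDeriv u f * g + f * leftDeriv u g +
        leftDeriv u f * leftDeriv u g := by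
      funext x; simp only [leftDeriv, Pi.mul_apply, Pi.add_apply]; ring
    have hf' := mem_derivKer_succ.1 hf u
    have hg' := mem_derivKer_succ.1 hg u
    -- The case $a=0$ is separate: a constant has zero derivative, and no natural number stands for
    -- its degree.
    have left : ∀ g', g' ∈ derivKer G (b + 1) → leftDeriv u f * g' ∈ derivKer G (a + b) := by
      intro g' hg'
      cases a with
      | zero => rw [mem_derivKer_zero.1 hf', zero_mul]; exact zero_mem _
      | succ a =>
        have := ih (a + b) (by omega) a b _ _ rfl hf' hg'
        rwa [Nat.add_right_comm]
    have right : f * leftDeriv u g ∈ derivKer G (a + b) := by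
      cases b with
      | zero => rw [mem_derivKer_zero.1 hg', mul_zero]; exact zero_mem _
      | succ b => exact ih (a + b) (by omega) a b _ _ rfl hf hg'
    rw [e]
    exact add_mem (add_mem (left g hg) right) (left _ (derivKer_le_succ G b hg'))

theorem const_mem_derivKer {G : Type u} [Group G] (z : ℂ) :
    (fun _ : G => z) ∈ derivKer G 1 := by
  rw [mem_derivKer_succ]
  intro u
  rw [mem_derivKer_zero]
  funext x; simp [leftDeriv]

theorem pow_mem_derivKer {G : Type u} [Group G] {d : ℕ} {f : G → ℂ} (hf : f ∈ derivKer G (d + 1))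
    (a : ℕ) : f ^ a ∈ derivKer G (d * a + 1) := by
  induction a with
  | zero => exact const_mem_derivKer 1
  | succ a ih =>
    rw [pow_succ]
    exact mul_mem_derivKer _ _ _ _ _ rfl ih hf

theorem prod_mem_derivKer {G : Type u} [Group G] {ι : Type*} (s : Finset ι) (d : ι → ℕ)
    (f : ι → G → ℂ) (hf : ∀ i ∈ s, f i ∈ derivKer G (d i + 1)) :
    ∏ i ∈ s, f i ∈ derivKer G (∑ i ∈ s, d i + 1) := by
  classical
  induction s using Finset.induction_on with
  | empty => exact const_mem_derivKer 1
  | insert i s hi ih =>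
    rw [Finset.prod_insert hi, Finset.sum_insert hi]
    exact mul_mem_derivKer _ _ _ _ _ rfl (hf i (by simp)) (ih fun j hj => hf j (by simp [hj]))

/-! ### Passing between scalar polynomials and polynomial maps. -/

/-- Powers of $e$ commute, so the derivative of $e^{p}$ is $e^{\partial p}$. Each derivative raises
$t$ and lowers $d$ by one, preserving $t+d\le i+1$; once $d=0$ the map is trivial. -/
theorem IsPolyMap.zpow {G : Type u} [Group G] {i : ℕ} {e : G} (he : e ∈ genComm G i) (m : ℕ) :
    ∀ (t d : ℕ) (p : G → ℤ), (fun x => (p x : ℂ)) ∈ derivKer G d → t + d ≤ i + 1 →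
      IsPolyMap m t fun x => e ^ p x := by
  induction m with
  | zero =>
    intro t d p hp htd x
    cases d with
    | zero =>
      have : (p x : ℂ) = 0 := congrFun (mem_derivKer_zero.1 hp) x
      simp only [Int.cast_eq_zero.1 this, zpow_zero]; exact one_mem _
    | succ d => exact zpow_mem (genComm_antitone G (by omega) he) _
  | succ m ih =>
    intro t d p hp htd
    cases d with
    | zero =>
      have h : (fun x => e ^ p x) = 1 := by
        funext x
        have : (p x : ℂ) = 0 := congrFun (mem_derivKer_zero.1 hp) x
        rw [Int.cast_eq_zero.1 this, zpow_zero]; rfl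
      rw [h]; exact one _ _
    | succ d =>
      refine ⟨fun x => zpow_mem (genComm_antitone G (by omega) he) _, fun u => ?_⟩
      have h : mulDeriv u (fun x => e ^ p x) = fun x => e ^ (p (u * x) - p x) := by
        funext x; simp only [mulDeriv]; rw [zpow_sub]
      rw [h]
      refine ih (t + 1) d _ ?_ (by omega)
      have := mem_derivKer_succ.1 hp u
      have e : leftDeriv u (fun x => (p x : ℂ)) = fun x => ((p (u * x) - p x : ℤ) : ℂ) := by
        funext x; simp [leftDeriv]
      rwa [e] at this

/-- The additive derivative of $\psi\circ b$ is $\psi$ of the multiplicative derivative of $b$.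
After $m$ derivatives the values lie in $\overline G_{t+m}\le\overline G_{i+1}$, where the class
vanishes. -/
theorem IsPolyMap.hom_gradedClass_mem_derivKer {G : Type u} [Group G] {i : ℕ}
    (ψ : GradedPiece G i →+ ℤ) (m : ℕ) :
    ∀ (t : ℕ) (b : G → G) (hb : ∀ x, b x ∈ genComm G i), IsPolyMap m t b → i + 1 ≤ t + m →
      (fun x => (ψ (gradedClass ⟨b x, hb x⟩) : ℂ)) ∈ derivKer G m := by
  induction m with
  | zero =>
    intro t b hb h ht
    rw [mem_derivKer_zero]
    funext x
    have h0 : gradedClass ⟨b x, hb x⟩ = gradedClass (1 : genComm G i) := by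
      rw [eq_comm, gradedClass_eq_iff]
      simpa using genComm_antitone G ht (h x)
    have h1 : gradedClass (1 : genComm G i) = 0 := rfl
    simp [h0, h1]
  | succ m ih =>
    intro t b hb h ht
    rw [mem_derivKer_succ]
    intro u
    have hb' : ∀ x, mulDeriv u b x ∈ genComm G i := fun x => mul_mem (hb _) (inv_mem (hb _))
    have e : leftDeriv u (fun x => (ψ (gradedClass ⟨b x, hb x⟩) : ℂ)) =
        fun x => (ψ (gradedClass ⟨mulDeriv u b x, hb' x⟩) : ℂ) := by
      funext x
      have h1 : (⟨b (u * x), hb _⟩ : genComm G i) = ⟨mulDeriv u b x, hb' x⟩ * ⟨b x, hb x⟩ := by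
        apply Subtype.ext; simp [mulDeriv]
      simp only [leftDeriv]
      rw [h1, gradedClass_mul, map_add]
      push_cast; ring
    rw [e]
    exact ih (t + 1) _ hb' (h.2 u) (by omega)

/-! ### Coordinates are polynomials of degree at most their weight. -/

namespace CoordinateSystem

variable {G : Type u} [Group G] (E : CoordinateSystem G)

theorem exists_eq_cumRk_add {K j : ℕ} (hj : j < cumRk G K) :
    ∃ i < K, ∃ t : Fin (rk G (i + 1)), j = cumRk G i + t := by
  induction K with
  | zero => simp [cumRk] at hj
  | succ K ih =>
    rcases lt_or_ge j (cumRk G K) with h | h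
    · obtain ⟨i, hi, t, e⟩ := ih h
      exact ⟨i, by omega, t, e⟩
    · rw [cumRk_succ] at hj
      exact ⟨K, by omega, ⟨j - cumRk G K, by omega⟩, by simp; omega⟩

theorem weight_eq (i : ℕ) (t : Fin (rk G (i + 1))) : E.weight (cumRk G i + t) = i + 1 := by
  -- A member of a basis has nonzero class, so it does not lie one step deeper in the filtration.
  have hnot : E.e (cumRk G i + t) ∉ genComm G (i + 2) := by
    intro h
    refine (E.linearIndependent i).ne_zero t ?_
    have h1 : gradedClass (1 : genComm G (i + 1)) = 0 := rfl
    rw [← h1, eq_comm, gradedClass_eq_iff]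
    simpa using h
  have h : {k : ℕ | E.e (cumRk G i + t) ∈ genComm G k} = Set.Iic (i + 1) := by
    ext k
    simp only [Set.mem_ofPred_eq, Set.mem_Iic]
    constructor
    · intro hk
      by_contra hlt
      exact hnot (genComm_antitone G (by omega) hk)
    · intro hk
      exact genComm_antitone G hk (E.mem i t)
  rw [weight, h]
  exact csSup_Iic

theorem e_mem_genComm_weight {K j : ℕ} (hj : j < cumRk G K) :
    E.e j ∈ genComm G (E.weight j) := by
  obtain ⟨i, -, t, rfl⟩ := exists_eq_cumRk_add hj
  rw [E.weight_eq]
  exact E.mem i t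

theorem one_le_weight {K j : ℕ} (hj : j < cumRk G K) : 1 ≤ E.weight j := by
  obtain ⟨i, -, t, rfl⟩ := exists_eq_cumRk_add hj
  rw [E.weight_eq]
  omega

theorem word_inv_mul_mem (k : ℕ) (x : G) :
    (E.word k (E.coord x))⁻¹ * x ∈ genComm G (k + 1) :=
  QuotientGroup.eq.1 ((E.coord_spec x).1 k).symm

theorem gradedClass_word_inv_mul (k : ℕ) (x : G) :
    gradedClass ⟨_, E.word_inv_mul_mem k x⟩ = ∑ t : Fin (rk G (k + 1)),
      E.coord x (cumRk G k + t) • gradedClass ⟨E.e (cumRk G k + t), E.mem k t⟩ := by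
  obtain ⟨b, hb, eb⟩ := E.word_succ k (E.coord x)
  rw [← eb, eq_comm, gradedClass_eq_iff]
  have h := E.word_inv_mul_mem (k + 1) x
  rw [hb] at h
  simpa [mul_assoc] using h

theorem coord_mem_derivKer (K : ℕ) : ∀ j < cumRk G K,
    (fun x => (E.coord x j : ℂ)) ∈ derivKer G (E.weight j + 1) := by
  induction K with
  | zero => intro j hj; simp [cumRk] at hj
  | succ K ih =>
    intro j hj
    rcases lt_or_ge j (cumRk G K) with h | h
    · exact ih j h
    rw [cumRk_succ] at hj
    obtain ⟨t, rfl⟩ : ∃ t : Fin (rk G (K + 1)), j = cumRk G K + t :=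
      ⟨⟨j - cumRk G K, by omega⟩, by simp; omega⟩
    rw [E.weight_eq]
    have hword : IsPolyMap (K + 2) 0 fun x => E.word K (E.coord x) := by
      refine IsPolyMap.list_prod (fun j x => E.e j ^ E.coord x j) _ fun j hj => ?_
      have hj := List.mem_range.1 hj
      exact IsPolyMap.zpow (E.e_mem_genComm_weight hj) _ 0 _ _ (ih j hj) (by omega)
    have hb : IsPolyMap (K + 2) 0 fun x => (E.word K (E.coord x))⁻¹ * x :=
      hword.inv.mul (IsPolyMap.id _)
    let B := Module.Basis.mk (E.linearIndependent K) (E.span_eq_top K).ge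
    -- Applied with level $t=0$ and $m=K+2$, just enough derivatives to reach $\overline G_{K+2}$;
    -- this is degree at most $K+1$, the weight of the block.
    have hB := hb.hom_gradedClass_mem_derivKer (B.coord t).toAddMonoidHom _ _ _
      (fun x => E.word_inv_mul_mem K x) (by omega)
    have e : ∀ x, (B.coord t).toAddMonoidHom (gradedClass ⟨_, E.word_inv_mul_mem K x⟩) =
        E.coord x (cumRk G K + t) := by
      intro x
      rw [E.gradedClass_word_inv_mul]
      have hBs : ∀ s : Fin (rk G (K + 1)), gradedClass ⟨E.e (cumRk G K + s), E.mem K s⟩ = B s := fun s => by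
        rw [Module.Basis.mk_apply]
      simp only [hBs]
      change B.coord t _ = _
      rw [map_sum]
      simp [Finsupp.single_apply]
    simpa only [e] using hB

theorem Monomial.eval_mem_derivKer {E : CoordinateSystem G} (q : E.Monomial) :
    q.eval ∈ derivKer G (q.degree + 1) := by
  obtain ⟨K, hK⟩ := q.exists_le
  have h := prod_mem_derivKer Finset.univ (fun i : Fin q.r => E.weight i * q.a i)
    (fun i => (fun x => (E.coord x i : ℂ)) ^ q.a i) fun i _ =>
      pow_mem_derivKer (E.coord_mem_derivKer K i (i.2.trans_le hK)) _
  have e : q.eval = q.coeff • ∏ i : Fin q.r, (fun x => (E.coord x i : ℂ)) ^ q.a i := by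
    funext x
    simp [Monomial.eval]
  rw [e]
  exact Submodule.smul_mem _ _ h

theorem IsCoordPolyOfDegreeLE.mem_polySpace {E : CoordinateSystem G} {k : ℤ} {f : G → ℂ}
    (h : E.IsCoordPolyOfDegreeLE k f) : f ∈ polySpace G k := by
  obtain ⟨t, q, hq, hf⟩ := h
  have e : f = ∑ s, (q s).eval := by funext x; simp [hf]
  rw [e]
  refine Submodule.sum_mem _ fun s _ => ?_
  have hs := hq s
  cases k with
  | ofNat k =>
    exact derivKer_mono G (by simpa using hs) (q s).eval_mem_derivKer
  | negSucc k =>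
    -- Degrees of monomials are natural numbers, so for negative $k$ there is no summand.
    exfalso
    have := Int.negSucc_lt_zero k
    omega

/-! ### The span of the coordinate monomials. -/

/-- The monomial `λ x_1^{a_1} ⋯ x_r^{a_r}` with exponents given by a function on `ℕ`. -/
def monomialOf (z : ℂ) {r : ℕ} (hr : ∃ k, r ≤ cumRk G k) (a : ℕ → ℕ) : E.Monomial :=
  ⟨z, r, hr, fun i => a i⟩

theorem monomialOf_eval (z : ℂ) {r : ℕ} (hr : ∃ k, r ≤ cumRk G k) (a : ℕ → ℕ) (x : G) :
    (E.monomialOf z hr a).eval x = z * ∏ i ∈ Finset.range r, (E.coord x i : ℂ) ^ a i := by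
  rw [Finset.prod_range]; rfl

theorem monomialOf_degree (z : ℂ) {r : ℕ} (hr : ∃ k, r ≤ cumRk G k) (a : ℕ → ℕ) :
    (E.monomialOf z hr a).degree = ∑ i ∈ Finset.range r, E.weight i * a i := by
  rw [Finset.sum_range]; rfl

/-- Padding with zero exponents gives a range of variables long enough to contain any further
coordinate to be multiplied in. -/
theorem Monomial.exists_extend {E : CoordinateSystem G} (q : E.Monomial) {K : ℕ}
    (hK : q.r ≤ cumRk G K) : ∃ a : ℕ → ℕ,
      q.eval = (E.monomialOf q.coeff ⟨K, le_rfl⟩ a).eval ∧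
      q.degree = (E.monomialOf q.coeff ⟨K, le_rfl⟩ a).degree := by
  let a : ℕ → ℕ := fun i => if h : i < q.r then q.a ⟨i, h⟩ else 0
  have ha : ∀ i : Fin q.r, q.a i = a i := fun i => by simp [a]
  have ha0 : ∀ i, i ∉ Finset.range q.r → a i = 0 := fun i hi => by
    simp only [Finset.mem_range] at hi; simp [a, hi]
  have hsub := Finset.range_subset_range.2 hK
  refine ⟨a, ?_, ?_⟩
  · funext x
    rw [monomialOf_eval, ← Finset.prod_subset hsub fun i _ hi => by rw [ha0 i hi, pow_zero],
      Finset.prod_range]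
    simp only [Monomial.eval, ha]
  · rw [monomialOf_degree, ← Finset.sum_subset hsub fun i _ hi => by rw [ha0 i hi, mul_zero],
      Finset.sum_range]
    simp only [Monomial.degree, ha]

theorem Monomial.exists_mul_coord_pow {E : CoordinateSystem G} (q : E.Monomial) {j K : ℕ}
    (hj : j < cumRk G K) (n : ℕ) : ∃ q' : E.Monomial,
      (∀ x, q'.eval x = (E.coord x j : ℂ) ^ n * q.eval x) ∧
        q'.degree = E.weight j * n + q.degree := by
  obtain ⟨K', hK'⟩ := q.exists_le
  obtain ⟨a, he, hd⟩ := q.exists_extend (hK'.trans (cumRk_mono G (le_max_left K' K)))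
  have hj' := Finset.mem_range.2 (hj.trans_le (cumRk_mono G (le_max_right K' K)))
  refine ⟨E.monomialOf q.coeff ⟨max K' K, le_rfl⟩ fun i => (if i = j then n else 0) + a i,
    fun x => ?_, ?_⟩
  · rw [he]
    simp only [monomialOf_eval, pow_add, Finset.prod_mul_distrib]
    rw [Finset.prod_eq_single_of_mem j hj' fun i _ hi => by simp [hi]]
    simp only [if_true]; ring
  · rw [hd]
    simp only [monomialOf_degree, mul_add, Finset.sum_add_distrib]
    rw [Finset.sum_eq_single_of_mem j hj' fun i _ hi => by simp [hi]]
    simp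

/-- The span of the coordinate monomials of degree at most `k`. -/
def coordPolys (k : ℕ) : Submodule ℂ (G → ℂ) :=
  Submodule.span ℂ {f | ∃ q : E.Monomial, q.degree ≤ k ∧ q.eval = f}

theorem isCoordPolyOfDegreeLE_of_mem_coordPolys {k : ℕ} {f : G → ℂ} (h : f ∈ E.coordPolys k) :
    E.IsCoordPolyOfDegreeLE k f := by
  obtain ⟨n, z, g, rfl⟩ := Submodule.mem_span_set'.1 h
  choose q hq hqe using fun s => (g s).2
  refine ⟨n, fun s => ⟨z s * (q s).coeff, (q s).r, (q s).exists_le, (q s).a⟩,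
    fun s => by exact_mod_cast hq s, fun x => ?_⟩
  simp only [Finset.sum_apply, Pi.smul_apply, ← hqe, smul_eq_mul, Monomial.eval, mul_assoc]

theorem coord_pow_mul_mem_coordPolys {k d : ℕ} {f : G → ℂ} (hf : f ∈ E.coordPolys k) {j K : ℕ}
    (hj : j < cumRk G K) (n : ℕ) (hd : E.weight j * n + k ≤ d) :
    (fun x => (E.coord x j : ℂ) ^ n * f x) ∈ E.coordPolys d := by
  let L : (G → ℂ) →ₗ[ℂ] (G → ℂ) := LinearMap.mulLeft ℂ fun x => (E.coord x j : ℂ) ^ n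
  suffices E.coordPolys k ≤ (E.coordPolys d).comap L from this hf
  refine Submodule.span_le.2 ?_
  rintro _ ⟨q, hq, rfl⟩
  obtain ⟨q', he, hdeg⟩ := q.exists_mul_coord_pow hj n
  exact Submodule.subset_span ⟨q', by omega, funext he⟩

theorem coordPolys_mono : Monotone E.coordPolys := fun _ _ hab =>
  Submodule.span_mono fun _ ⟨q, hq, e⟩ => ⟨q, hq.trans hab, e⟩

theorem const_mem_coordPolys (z : ℂ) : (fun _ : G => z) ∈ E.coordPolys 0 :=
  Submodule.subset_span ⟨E.monomialOf z (r := 0) ⟨0, Nat.zero_le _⟩ 0, by simp [monomialOf_degree],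
    by funext x; simp [monomialOf_eval]⟩

theorem polynomial_coord_mul_mem_coordPolys {k d : ℕ} {f : G → ℂ} (hf : f ∈ E.coordPolys k)
    {j K : ℕ} (hj : j < cumRk G K) (p : Polynomial ℂ) (hd : E.weight j * p.natDegree + k ≤ d) :
    (fun x => p.eval (E.coord x j : ℂ) * f x) ∈ E.coordPolys d := by
  have e : (fun x => p.eval (E.coord x j : ℂ) * f x) = ∑ n ∈ Finset.range (p.natDegree + 1),
      p.coeff n • fun x => (E.coord x j : ℂ) ^ n * f x := by
    funext x
    simp only [Polynomial.eval_eq_sum_range, Finset.sum_apply, Pi.smul_apply, smul_eq_mul,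
      Finset.sum_mul, mul_assoc]
  rw [e]
  refine Submodule.sum_mem _ fun n hn => Submodule.smul_mem _ _ ?_
  refine E.coord_pow_mul_mem_coordPolys hf hj n (le_trans ?_ hd)
  have := Nat.mul_le_mul_left (E.weight j) (Finset.mem_range_succ_iff.1 hn)
  omega

end CoordinateSystem

/-! ### Derivatives along $\overline G_i$ lower the degree by $i$. -/

/-- The elements `u` whose left derivative lowers the degree by `i`. -/
def derivLowering (G : Type u) [Group G] (i : ℕ) : Subgroup G where
  carrier := {u | ∀ d, ∀ f ∈ derivKer G (d + i), leftDeriv u f ∈ derivKer G d}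
  mul_mem' := by
    intro u v hu hv d f hf
    have e : leftDeriv (u * v) f = (fun x => leftDeriv u f (v * x)) + leftDeriv v f := by
      funext x; simp [leftDeriv, mul_assoc]
    rw [e]
    exact add_mem (comp_mul_left_mem_derivKer (hu d f hf) v) (hv d f hf)
  one_mem' := by
    intro d f _
    have e : leftDeriv 1 f = 0 := by funext x; simp [leftDeriv]
    rw [e]; exact zero_mem _
  inv_mem' := by
    intro u hu d f hf
    have e : leftDeriv u⁻¹ f = -fun x => leftDeriv u f (u⁻¹ * x) := by
      funext x; simp [leftDeriv]
    rw [e]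
    exact neg_mem (comp_mul_left_mem_derivKer (hu d f hf) u⁻¹)

theorem derivLowering_one (G : Type u) [Group G] : derivLowering G 1 = ⊤ :=
  eq_top_iff.2 fun u _ _ _ hf => mem_derivKer_succ.1 hf u

theorem commutator_derivLowering_le (G : Type u) [Group G] (i j : ℕ) :
    ⁅derivLowering G i, derivLowering G j⁆ ≤ derivLowering G (i + j) := by
  rw [Subgroup.commutator_le]
  intro a ha b hb d f hf
  -- At $y=a^{-1}b^{-1}x$ the difference of the mixed derivatives is $f(aby)-f(bay)$, and $bay=x$.
  have e : leftDeriv ⁅a, b⁆ f = fun x => (leftDeriv b (leftDeriv a f) -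
      leftDeriv a (leftDeriv b f)) ((a⁻¹ * b⁻¹) * x) := by
    funext x
    simp only [leftDeriv, commutatorElement_def, Pi.sub_apply, mul_assoc, mul_inv_cancel_left]
    ring
  rw [e]
  refine comp_mul_left_mem_derivKer (sub_mem ?_ ?_) _
  · refine hb _ _ (ha _ _ ?_)
    rwa [add_assoc, add_comm j]
  · refine ha _ _ (hb _ _ ?_)
    rwa [add_assoc]

theorem lowerCentralSeries_le_derivLowering (G : Type u) [Group G] (n : ℕ) :
    (⊤ : Subgroup G).lowerCentralSeries n ≤ derivLowering G (n + 1) := by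
  induction n with
  | zero => rw [zero_add, derivLowering_one]; exact le_top
  | succ n ih =>
    refine le_trans ?_ (commutator_derivLowering_le G (n + 1) 1)
    rw [derivLowering_one]
    exact Subgroup.commutator_mono ih le_rfl

/-- Roots are handled by raising $j$ one step at a time: if $\partial_uf$ is already one degree
above the target, then $\partial_{u^m}f\equiv m\,\partial_uf$ modulo the target, and $n$ is
invertible in $\mathbb C$. -/
theorem mem_derivLowering_of_pow_mem {G : Type u} [Group G] {i n : ℕ} (hn : 0 < n) {u : G}
    (h : u ^ n ∈ derivLowering G i) : ∀ j, 1 ≤ j → j ≤ i → u ∈ derivLowering G j := by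
  intro j hj
  induction j, hj using Nat.le_induction with
  | base => intro _; rw [derivLowering_one]; exact Subgroup.mem_top _
  | succ j hj ih =>
    intro hji d f hf
    have h1 : leftDeriv u f ∈ derivKer G (d + 1) := ih (by omega) _ _ (by rwa [add_right_comm])
    have key : ∀ m : ℕ, leftDeriv (u ^ m) f - (m : ℂ) • leftDeriv u f ∈ derivKer G d := by
      intro m
      induction m with
      | zero =>
        have e : leftDeriv (u ^ 0) f - ((0 : ℕ) : ℂ) • leftDeriv u f = 0 := by
          funext x; simp [leftDeriv]
        rw [e]; exact zero_mem _
      | succ m ihm =>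
        have e : leftDeriv (u ^ (m + 1)) f - ((m + 1 : ℕ) : ℂ) • leftDeriv u f =
            (leftDeriv (u ^ m) f - (m : ℂ) • leftDeriv u f) +
              leftDeriv (u ^ m) (leftDeriv u f) := by
          funext x
          simp only [leftDeriv, Pi.sub_apply, Pi.add_apply, Pi.smul_apply, smul_eq_mul,
            pow_succ', mul_assoc]
          push_cast; ring
        rw [e]
        exact add_mem ihm (mem_derivKer_succ.1 h1 _)
    have h2 : leftDeriv (u ^ n) f ∈ derivKer G d := by
      refine h d f (derivKer_mono G ?_ hf)
      omega
    have h3 := sub_mem h2 (key n)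
    rw [sub_sub_cancel] at h3
    exact (Submodule.smul_mem_iff _ (Nat.cast_ne_zero.2 hn.ne')).1 h3

theorem genComm_le_derivLowering (G : Type u) [Group G] {i : ℕ} (hi : 1 ≤ i) :
    genComm G i ≤ derivLowering G i := by
  rintro u ⟨n, hn, h⟩
  refine mem_derivLowering_of_pow_mem hn (i := i) ?_ i hi le_rfl
  have := lowerCentralSeries_le_derivLowering G (i - 1) h
  rwa [Nat.sub_add_cancel hi] at this

/-- Truncated subtraction is harmless: for $i\ge d$ the derivative lies in `derivKer G 0`, which is
zero. -/
theorem leftDeriv_mem_derivKer_sub {G : Type u} [Group G] {i d : ℕ} (hi : 1 ≤ i) {u : G}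
    (hu : u ∈ genComm G i) {f : G → ℂ} (hf : f ∈ derivKer G d) :
    leftDeriv u f ∈ derivKer G (d - i) :=
  genComm_le_derivLowering G hi hu _ _ (derivKer_mono G (by omega) hf)

theorem iterate_leftDeriv_mem_derivKer {G : Type u} [Group G] {i d : ℕ} (hi : 1 ≤ i) {u : G}
    (hu : u ∈ genComm G i) {f : G → ℂ} (hf : f ∈ derivKer G d) (a : ℕ) :
    (leftDeriv u)^[a] f ∈ derivKer G (d - i * a) := by
  induction a with
  | zero => exact hf
  | succ a ih =>
    rw [Function.iterate_succ_apply', mul_add, mul_one, ← Nat.sub_sub]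
    exact leftDeriv_mem_derivKer_sub hi hu ih

/-! ### Newton's forward difference formula. -/

/-- The binomial coefficient `X choose a` as a polynomial. -/
noncomputable def binomPoly (a : ℕ) : Polynomial ℂ :=
  Polynomial.C ((a.factorial : ℂ)⁻¹) * descPochhammer ℂ a

theorem binomPoly_natDegree_le (a : ℕ) : (binomPoly a).natDegree ≤ a :=
  (Polynomial.natDegree_C_mul_le _ _).trans (descPochhammer_natDegree ℂ a).le

theorem binomPoly_zero_eval (z : ℂ) : (binomPoly 0).eval z = 1 := by simp [binomPoly]

theorem binomPoly_succ_eval_zero (a : ℕ) : (binomPoly (a + 1)).eval 0 = 0 := by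
  simp [binomPoly, descPochhammer_succ_left]

theorem binomPoly_succ_eval_add_one (a : ℕ) (z : ℂ) :
    (binomPoly (a + 1)).eval (z + 1) = (binomPoly (a + 1)).eval z + (binomPoly a).eval z := by
  have hl : (descPochhammer ℂ (a + 1)).eval (z + 1) = (z + 1) * (descPochhammer ℂ a).eval z := by
    simp [descPochhammer_succ_left]
  have hr : (descPochhammer ℂ (a + 1)).eval z = (descPochhammer ℂ a).eval z * (z - a) := by
    simp [descPochhammer_succ_right]
  have ha : (a.factorial : ℂ) ≠ 0 := Nat.cast_ne_zero.2 a.factorial_ne_zero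
  have ha' : (a : ℂ) + 1 ≠ 0 := Nat.cast_add_one_ne_zero a
  simp only [binomPoly, Polynomial.eval_mul, Polynomial.eval_C, hl, hr, Nat.factorial_succ]
  push_cast
  field_simp
  ring

theorem apply_zpow_mul_eq_sum {G : Type u} [Group G] (e : G) (f : G → ℂ) (N : ℕ)
    (hN : (leftDeriv e)^[N + 1] f = 0) (n : ℤ) (y : G) :
    f (e ^ n * y) = ∑ a ∈ Finset.range (N + 1), (binomPoly a).eval (n : ℂ) *
      (leftDeriv e)^[a] f y := by
  -- Pascal's rule: raising $n$ by one in the right-hand side amounts to replacing $y$ by $ey$. As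
  -- an identity over all integers it drives the induction in both directions.
  have step : ∀ (n : ℤ) (y : G), (∑ a ∈ Finset.range (N + 1), (binomPoly a).eval ((n + 1 : ℤ) : ℂ) *
      (leftDeriv e)^[a] f y) = ∑ a ∈ Finset.range (N + 1), (binomPoly a).eval (n : ℂ) *
      (leftDeriv e)^[a] f (e * y) := by
    intro n y
    have h1 : ∀ a, (leftDeriv e)^[a] f (e * y) =
        (leftDeriv e)^[a] f y + (leftDeriv e)^[a + 1] f y := by
      intro a
      rw [Function.iterate_succ_apply']
      simp [leftDeriv]
    simp only [h1, mul_add, Finset.sum_add_distrib]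
    rw [Finset.sum_range_succ (fun a => (binomPoly a).eval (n : ℂ) * (leftDeriv e)^[a + 1] f y), hN,
      Finset.sum_range_succ', Finset.sum_range_succ']
    push_cast
    simp only [binomPoly_succ_eval_add_one, binomPoly_zero_eval, add_mul, Finset.sum_add_distrib,
      Pi.zero_apply]
    ring
  induction n using Int.induction_on generalizing y with
  | zero =>
    rw [Finset.sum_range_succ']
    simp [binomPoly_succ_eval_zero, binomPoly_zero_eval]
  | succ n ih => rw [step, ← ih, zpow_add_one, mul_assoc]
  | pred n ih =>
    have h := step (-(n : ℤ) - 1) (e⁻¹ * y)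
    rw [sub_add_cancel, ← ih, mul_inv_cancel_left] at h
    rw [← h, zpow_sub_one, mul_assoc]

/-! ### Expanding a polynomial in coordinates. -/

namespace CoordinateSystem

variable {G : Type u} [Group G] (E : CoordinateSystem G)

/-- Induction on the list, for all $k$ and $f$ at once, since removing the leftmost factor replaces
$f$ by its iterated derivatives along $e_j$. -/
theorem apply_list_prod_mem_coordPolys {K : ℕ} (l : List ℕ) (hl : ∀ j ∈ l, j < cumRk G K) :
    ∀ (k : ℕ) (f : G → ℂ), f ∈ derivKer G (k + 1) →
      (fun x => f (l.map fun j => E.e j ^ E.coord x j).prod) ∈ E.coordPolys k := by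
  induction l with
  | nil =>
    intro k f _
    exact E.coordPolys_mono (Nat.zero_le k) (E.const_mem_coordPolys (f 1))
  | cons j l ih =>
    intro k f hf
    have hj := hl j (by simp)
    have hw := E.one_le_weight hj
    have hT := iterate_leftDeriv_mem_derivKer hw (E.e_mem_genComm_weight hj) hf
    have hN : (leftDeriv (E.e j))^[k + 1] f = 0 := by
      rw [← mem_derivKer_zero]
      have := hT (k + 1)
      rwa [Nat.sub_eq_zero_of_le (Nat.le_mul_of_pos_left _ hw)] at this
    have e : (fun x => f ((j :: l).map fun j => E.e j ^ E.coord x j).prod) =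
        ∑ a ∈ Finset.range (k + 1), fun x => (binomPoly a).eval (E.coord x j : ℂ) *
          (leftDeriv (E.e j))^[a] f (l.map fun j => E.e j ^ E.coord x j).prod := by
      funext x
      rw [List.map_cons, List.prod_cons, apply_zpow_mul_eq_sum _ _ _ hN, Finset.sum_apply]
    rw [e]
    refine Submodule.sum_mem _ fun a _ => ?_
    -- Terms with $\sigma(j)a>k$ vanish; in the others the degree removed from $f$ bounds that of
    -- the binomial factor.
    rcases le_or_gt (E.weight j * a) k with h | h
    · refine E.polynomial_coord_mul_mem_coordPolys (k := k - E.weight j * a)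
        (ih (fun i hi => hl i (by simp [hi])) _ _ ?_) hj _ ?_
      · have := hT a
        rwa [Nat.sub_add_comm h] at this
      · have := Nat.mul_le_mul_left (E.weight j) (binomPoly_natDegree_le a)
        omega
    · have h0 : (leftDeriv (E.e j))^[a] f = 0 := by
        rw [← mem_derivKer_zero]
        have := hT a
        rwa [Nat.sub_eq_zero_of_le h] at this
      simp only [h0, Pi.zero_apply, mul_zero]
      exact zero_mem _

theorem mem_coordPolys_of_mem_derivKer {k : ℕ} {f : G → ℂ} (hf : f ∈ derivKer G (k + 1)) :
    f ∈ E.coordPolys k := by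
  have h := E.apply_list_prod_mem_coordPolys (K := k) (List.range (cumRk G k))
    (fun j hj => List.mem_range.1 hj) k f hf
  have e : f = fun x => f (E.word k (E.coord x)) := by
    funext x
    -- The coordinates leave the remainder on the right of the word; normality moves it to the left,
    -- where $\partial$ acts.
    have hz : x * (E.word k (E.coord x))⁻¹ ∈ genComm G (k + 1) := by
      have := (genComm_normal G (k + 1)).conj_mem _ (E.word_inv_mul_mem k x) (E.word k (E.coord x))
      simpa using this
    have h0 := leftDeriv_mem_derivKer_sub (Nat.succ_pos k) hz hf
    rw [Nat.sub_self, mem_derivKer_zero] at h0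
    have := congrFun h0 (E.word k (E.coord x))
    simpa [leftDeriv, sub_eq_zero] using this
  rw [e]
  exact h

end CoordinateSystem

end GroupPoly

theorem mainTheorem6 {G : Type*} [Group G] [Group.FG G] (E : GroupPoly.CoordinateSystem G)
    (k : ℤ) (f : G → ℂ) :
    f ∈ GroupPoly.polySpace G k ↔ E.IsCoordPolyOfDegreeLE k f := by
  refine ⟨fun h => ?_, fun h => h.mem_polySpace⟩
  cases k with
  | ofNat k => exact E.isCoordPolyOfDegreeLE_of_mem_coordPolys (E.mem_coordPolys_of_mem_derivKer h)
  | negSucc k =>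
    have h0 : f = 0 := (Submodule.mem_bot ℂ).1 h
    exact ⟨0, Fin.elim0, fun s => s.elim0, fun x => by simp [h0]⟩
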